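/- Let $A=(a_{ij})_{0\le i,j\le r}$ be a symmetrizable generalized Cartan matrix of affine type and rank $r$, and let $\vec a,\vec c$ be the minimal positive integer vectors with $A\vec a=0$, $\vec c^{\,t}A=0$. Let $\mathfrak h$ be the complex vector space with basis $h_0,\dots,h_r,d$; let $\alpha_j,\varpi_j\in\mathfrak h^*$ be given by $\alpha_j(h_i)=a_{ij}$, $\alpha_j(d)=\delta_{j0}$, $\varpi_j(h_i)=\delta_{ij}$, $\varpi_j(d)=0$; let $\delta=\sum_i a_i\alpha_i$, $h^\vee=\sum_i c_i$, and let $\rho\in\mathfrak h^*$ satisfy $\rho(h_i)=1$ for all $i$. The level of $\lambda\in\mathfrak h^*$ is $\sum_i c_i\lambda(h_i)$. Let $(\,,)$ be the normalized invariant form, so that $(\lambda,\alpha_i)=\frac{c_i}{a_i}\lambda(h_i)$, and put $\langle\lambda,\gamma^\vee\rangle=2(\lambda,\gamma)/(\gamma,\gamma)$. Let $X^+=\{\lambda\in\mathfrak h^*:\lambda(h_i)\in\mathbb Z_{\ge0}\ \forall i\}$. Let $\Phi_{\mathrm{re}}$ be the set of real roots (the images of the simple roots $\alpha_i$ under the Weyl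 group) and $\Phi_{\mathrm{re}}^+$ the set of positive ones. For $i\in\{1,2,3\}$ let $\Phi_i^+$ be the set of $\gamma_0\in\Phi_{\mathrm{re}}^+$ such that, for $n\in\mathbb Z$, $\gamma_0+n\delta\in\Phi_{\mathrm{re}}$ if and only if $i\mid n$, and $\gamma_0-i\delta\notin\Phi_{\mathrm{re}}^+$. (Thus $\Phi_{\mathrm{re}}^+=\bigcup_{i=1}^3\{\gamma_0+t\delta:\gamma_0\in\Phi_i^+,\ t\in i\mathbb Z_{\ge0}\}$.) Let $p$ be a prime. For $\lambda,\mu\in X^+$ and $\gamma\in\Phi_{\mathrm{re}}^+$, the weight $\mu$ is $\gamma$-mirrored to $\lambda$ if, for some integer $e\ge1$, writing $\langle\lambda+\rho,\gamma^\vee\rangle=Mp^e+D$ with $M,D\in\mathbb Z$ and $0\le D<p^e$, one has $\mu=s_{\gamma,Mp^e}\cdot\lambda$, where $s_{\gamma,m}\cdot\lambda=\lambda-(\langle\lambda+\rho,\gamma^\vee\rangle-m)\gamma$; that is, $\mu=\lambda-D\gamma$. Let $Y^+$ be the set of $\lambda\in\sum_i\mathbb Z_{\ge0}\varpi_i$ such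 that some $\mu\in X^+$ is $\gamma$-mirrored to $\lambda$ for some $\gamma\in\Phi_{\mathrm{re}}^+$. **Proposition.** Let $\lambda\in X^+$ have level $\ell$ and let $\gamma_0\in\Phi_i^+$ for some $i\in\{1,2,3\}$. Then $C_i=\frac{2i}{(\gamma_0,\gamma_0)}(\ell+h^\vee)$ and $N=\langle\lambda+\rho,\gamma_0^\vee\rangle$ are integers, and the following hold. 1. If $\lambda-\gcd(C_i,p)\gamma_0\in X^+$, then some $\mu\in X^+$ is $\gamma$-mirrored to $\lambda$ for some $\gamma\in\Phi_{\mathrm{re}}^+$; if moreover $\lambda(d)=0$, then $\lambda\in Y^+$. 2. If $\lambda-\gcd(C_i,p)\gamma_0\in X^+$ and it is not the case that both $p^2\mid C_i$ and $p\mid N$, then $\mu$ and $\gamma$ as in 1 can be chosen with $\mu\neq\lambda$. 3. If $e\ge 0$ is an integer with $p^e\nmid C_i$ and $\lambda-\gcd(C_i,p^e)\gamma_0\in X^+$, then $\mu$ and $\gamma$ as in 1 can be chosen with $\mu\neq\lambda$. -/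

import Mathlib

namespace AffineWeyl

/-- `A`, with rows and columns indexed by `0, …, r`, is a symmetrizable generalized Cartan matrix
of affine type and of rank `r`. -/
structure IsAffineGCM {r : ℕ} (A : Matrix (Fin (r + 1)) (Fin (r + 1)) ℤ) : Prop where
  diag : ∀ i, A i i = 2
  offDiag_nonpos : ∀ i j, i ≠ j → A i j ≤ 0
  zero_symm : ∀ i j, A i j = 0 → A j i = 0
  indecomposable : ∀ S : Set (Fin (r + 1)), S.Nonempty → Sᶜ.Nonempty →
    ∃ i ∈ S, ∃ j ∈ Sᶜ, A i j ≠ 0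
  symmetrizable : ∃ ε : Fin (r + 1) → ℚ, (∀ i, ε i ≠ 0) ∧
    ∀ i j, ε i * (A i j : ℚ) = ε j * (A j i : ℚ)
  rank_eq : (A.map (Int.cast : ℤ → ℚ)).rank = r
  affine : ∃ u : Fin (r + 1) → ℤ, (∀ i, 0 < u i) ∧ A.mulVec u = 0

/-- `u` is the minimal positive integer vector with `A u = 0`. -/
def IsMarks {r : ℕ} (A : Matrix (Fin (r + 1)) (Fin (r + 1)) ℤ) (u : Fin (r + 1) → ℤ) : Prop :=
  IsLeast {v : Fin (r + 1) → ℤ | (∀ i, 0 < v i) ∧ A.mulVec v = 0} u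

/-- The Cartan subalgebra of the affine algebra: the complex vector space with basis
`h 0, …, h r` (first component) and the scaling element `d` (second component). -/
abbrev Cartan (r : ℕ) : Type := (Fin (r + 1) → ℂ) × ℂ

/-- The simple coroot `h i`. -/
def simpleCoroot {r : ℕ} (i : Fin (r + 1)) : Cartan r := (Pi.single i 1, 0)

/-- The scaling element `d`. -/
def scaling (r : ℕ) : Cartan r := (0, 1)

/-- The dual of the Cartan subalgebra. -/
abbrev Weight (r : ℕ) : Type := Module.Dual ℂ (Cartan r)

/-- The simple root `α j`, with `α j (h i) = A i j` and `α j (d) = 1` if `j = 0`, else `0`. -/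
noncomputable def simpleRoot {r : ℕ} (A : Matrix (Fin (r + 1)) (Fin (r + 1)) ℤ)
    (j : Fin (r + 1)) : Weight r :=
  (∑ i, (A i j : ℂ) • (LinearMap.proj i ∘ₗ LinearMap.fst ℂ (Fin (r + 1) → ℂ) ℂ)) +
    (if j = 0 then (1 : ℂ) else 0) • LinearMap.snd ℂ (Fin (r + 1) → ℂ) ℂ

/-- The fundamental weight `ϖ j`, with `ϖ j (h i) = 1` if `i = j`, else `0`, and `ϖ j (d) = 0`. -/
noncomputable def fundamentalWeight {r : ℕ} (j : Fin (r + 1)) : Weight r :=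
  LinearMap.proj j ∘ₗ LinearMap.fst ℂ (Fin (r + 1) → ℂ) ℂ

theorem simpleRoot_simpleCoroot {r : ℕ} (A : Matrix (Fin (r + 1)) (Fin (r + 1)) ℤ)
    (i j : Fin (r + 1)) : simpleRoot A j (simpleCoroot i) = (A i j : ℂ) := by
  by_cases h : j = 0 <;> simp [simpleRoot, simpleCoroot, Pi.single_apply, h]

theorem simpleRoot_scaling {r : ℕ} (A : Matrix (Fin (r + 1)) (Fin (r + 1)) ℤ)
    (j : Fin (r + 1)) : simpleRoot A j (scaling r) = if j = 0 then 1 else 0 := by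
  by_cases h : j = 0 <;> simp [simpleRoot, scaling, h]

/-- The root lattice: `g` stands for `∑ i, g i • α i`. -/
abbrev RootLattice (r : ℕ) : Type := Fin (r + 1) → ℤ

/-- The element of the dual Cartan subalgebra given by an element of the root lattice. -/
noncomputable def toWeight {r : ℕ} (A : Matrix (Fin (r + 1)) (Fin (r + 1)) ℤ)
    (g : RootLattice r) : Weight r :=
  ∑ i, (g i : ℂ) • simpleRoot A i

/-- The simple reflection `s i` on the root lattice, `g ↦ g - g (h i) α i`. -/
def simpleReflection {r : ℕ} (A : Matrix (Fin (r + 1)) (Fin (r + 1)) ℤ) (i : Fin (r + 1))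
    (g : RootLattice r) : RootLattice r :=
  g - (A.mulVec g i) • Pi.single i 1

/-- Real roots: the images of the simple roots under the group generated by the simple
reflections. -/
inductive IsRealRoot {r : ℕ} (A : Matrix (Fin (r + 1)) (Fin (r + 1)) ℤ) : RootLattice r → Prop
  | simple (i : Fin (r + 1)) : IsRealRoot A (Pi.single i 1)
  | reflect (i : Fin (r + 1)) (g : RootLattice r) :
      IsRealRoot A g → IsRealRoot A (simpleReflection A i g)

/-- Positive real roots. -/
def IsPosRealRoot {r : ℕ} (A : Matrix (Fin (r + 1)) (Fin (r + 1)) ℤ) (g : RootLattice r) :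
    Prop :=
  IsRealRoot A g ∧ ∀ i, 0 ≤ g i

/-- The set `Φ_i⁺`, where `a` is the coefficient vector of `δ`: the positive real roots `γ₀` whose
`δ`-string has period `i` (that is, `γ₀ + n δ` is a real root exactly for `n ∈ iℤ`) and which are
the first positive member of that string. So the positive real roots with period `i` are
the `γ₀ + t δ` with `γ₀ ∈ Φ_i⁺` and `t ∈ iℤ_{≥ 0}`. -/
def baseRoots {r : ℕ} (A : Matrix (Fin (r + 1)) (Fin (r + 1)) ℤ) (a : Fin (r + 1) → ℤ) (i : ℕ) :
    Set (RootLattice r) :=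
  {g | IsPosRealRoot A g ∧ (∀ n : ℤ, IsRealRoot A (g + n • a) ↔ (i : ℤ) ∣ n) ∧
    ¬ IsPosRealRoot A (g - (i : ℤ) • a)}

/-- The normalized invariant form `(μ, g)` of a weight `μ` with an element `g = ∑ g i α i` of the
root lattice. It is determined by `(μ, α i) = (c i / a i) μ (h i)`;
in particular `(α i, α j) = (c i / a i) A i j` and `(μ, δ) = μ (c)`. -/
noncomputable def form {r : ℕ} (a c : Fin (r + 1) → ℤ) (μ : Weight r) (g : RootLattice r) : ℂ :=
  ∑ i, (g i : ℂ) * ((c i : ℂ) / (a i : ℂ)) * μ (simpleCoroot i)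

/-- The norm `(g, g)`. -/
noncomputable def normSq {r : ℕ} (A : Matrix (Fin (r + 1)) (Fin (r + 1)) ℤ)
    (a c : Fin (r + 1) → ℤ) (g : RootLattice r) : ℂ :=
  form a c (toWeight A g) g

/-- `⟨μ, g^∨⟩ = 2 (μ, g) / (g, g)`. -/
noncomputable def corootPairing {r : ℕ} (A : Matrix (Fin (r + 1)) (Fin (r + 1)) ℤ)
    (a c : Fin (r + 1) → ℤ) (μ : Weight r) (g : RootLattice r) : ℂ :=
  2 * form a c μ g / normSq A a c g

/-- The value of a weight at the central element `∑ c i h i`. -/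
noncomputable def level {r : ℕ} (c : Fin (r + 1) → ℤ) (μ : Weight r) : ℂ :=
  μ (∑ i, (c i : ℂ) • simpleCoroot i)

/-- The set `X⁺` of dominant integral weights. -/
def dominantWeights (r : ℕ) : Set (Weight r) :=
  {μ | ∀ i, ∃ n : ℕ, μ (simpleCoroot i) = n}

/-- The affine reflection `s_{g,m}(μ) = μ - ⟨μ, g^∨⟩ g + m g`. -/
noncomputable def affineReflection {r : ℕ} (A : Matrix (Fin (r + 1)) (Fin (r + 1)) ℤ)
    (a c : Fin (r + 1) → ℤ) (g : RootLattice r) (m : ℤ) (μ : Weight r) : Weight r :=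
  μ - corootPairing A a c μ g • toWeight A g + (m : ℂ) • toWeight A g

/-- The dot action `s_{g,m} • μ = s_{g,m}(μ + ρ) - ρ`. -/
noncomputable def dotReflection {r : ℕ} (A : Matrix (Fin (r + 1)) (Fin (r + 1)) ℤ)
    (a c : Fin (r + 1) → ℤ) (ρ : Weight r) (g : RootLattice r) (m : ℤ) (μ : Weight r) :
    Weight r :=
  affineReflection A a c g m (μ + ρ) - ρ

/-- `μ` is `(g, e)`-mirrored to `ν`: both are dominant integral, `⟨ν + ρ, g^∨⟩ = M p^e + D` with
integers `M`, `D`, `0 ≤ D < p^e`, and `μ` is the nearest lower `p^e`-reflection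
`s_{g, M p^e} • ν` (which equals `ν - D g`). -/
def IsMirroredAt {r : ℕ} (A : Matrix (Fin (r + 1)) (Fin (r + 1)) ℤ) (a c : Fin (r + 1) → ℤ)
    (ρ : Weight r) (p : ℕ) (g : RootLattice r) (e : ℕ) (μ ν : Weight r) : Prop :=
  μ ∈ dominantWeights r ∧ ν ∈ dominantWeights r ∧
    ∃ M D : ℤ, corootPairing A a c (ν + ρ) g = ((M * (p : ℤ) ^ e + D : ℤ) : ℂ) ∧
      0 ≤ D ∧ D < (p : ℤ) ^ e ∧ μ = dotReflection A a c ρ g (M * (p : ℤ) ^ e) ν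

/-- `μ` is `g`-mirrored to `ν`. -/
def IsMirrored {r : ℕ} (A : Matrix (Fin (r + 1)) (Fin (r + 1)) ℤ) (a c : Fin (r + 1) → ℤ)
    (ρ : Weight r) (p : ℕ) (g : RootLattice r) (μ ν : Weight r) : Prop :=
  ∃ e : ℕ, 0 < e ∧ IsMirroredAt A a c ρ p g e μ ν

/-- The set `Y⁺`: nonnegative integral combinations `ν` of the fundamental weights such that some
dominant integral weight is `g`-mirrored to `ν` for some positive real root `g`. -/
def Yplus {r : ℕ} (A : Matrix (Fin (r + 1)) (Fin (r + 1)) ℤ) (a c : Fin (r + 1) → ℤ)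
    (ρ : Weight r) (p : ℕ) : Set (Weight r) :=
  {ν | (∃ ξ : Fin (r + 1) → ℕ, ν = ∑ i, (ξ i : ℂ) • fundamentalWeight i) ∧
    ∃ μ ∈ dominantWeights r, ∃ g, IsPosRealRoot A g ∧ IsMirrored A a c ρ p g μ ν}

end AffineWeyl

/-!
Adding a multiple of `δ` to a root `γ₀` changes neither `(γ₀, γ₀)` nor the values of `γ₀` on the
simple coroots, but it changes `⟨λ + ρ, γ₀^∨⟩`: along the string `γ₀ + k i δ` this number runs
through the arithmetic progression `N + k C`, whose terms are integers because the simple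
reflections of `A` and of its transpose carry roots to roots and coroots to coroots. Modulo `p ^ e`
the progression therefore meets every residue `D` congruent to `N` modulo `gcd (C, p ^ e)`, and the
corresponding root mirrors `λ` to `λ - D γ`, which agrees with `λ - D γ₀` on the simple coroots.
One can take `0 ≤ D ≤ gcd (C, p ^ e)` and `D < p ^ e`, and even `D ≠ 0` unless `p ^ e` divides both
`C` and `N`; then `λ - D γ₀` is dominant since it lies between the dominant weights `λ` and
`λ - gcd (C, p ^ e) γ₀`.
-/

namespace AffineWeyl

/-- The integral vectors `a` and `c` serve as marks and comarks of `A`: `a` is a null vector of `A`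
and the diagonal matrix of the `c i / a i` symmetrizes `A`. The equation `symm` is cleared of
denominators. -/
structure HasMarks {r : ℕ} (A : Matrix (Fin (r + 1)) (Fin (r + 1)) ℤ)
    (a c : Fin (r + 1) → ℤ) : Prop where
  diag : ∀ i, A i i = 2
  mulVec_mark : A.mulVec a = 0
  mark_ne_zero : ∀ i, a i ≠ 0
  comark_ne_zero : ∀ i, c i ≠ 0
  symm : ∀ i j, c i * a j * A i j = c j * a i * A j i

/-- The integral vector `m` gives the coroot of `g`: identifying `α j` with `(c j / a j) h j` by the
form, `2 g / (g, g) = ∑ j, m j • h j`. The equation is multiplied by `(g, g)`. -/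
def IsCoroot {r : ℕ} (A : Matrix (Fin (r + 1)) (Fin (r + 1)) ℤ) (a c : Fin (r + 1) → ℤ)
    (g : RootLattice r) (m : Fin (r + 1) → ℤ) : Prop :=
  ∀ j, 2 * ((g j : ℂ) * ((c j : ℂ) / a j)) = m j * normSq A a c g

theorem exists_smul_eq_of_rank_add_one_eq_card {m n K : Type*} [Fintype n] [Field K]
    {M : Matrix m n K} (hM : M.rank + 1 = Fintype.card n) {u v : n → K} (hu : u ≠ 0)
    (hMu : M.mulVec u = 0) (hMv : M.mulVec v = 0) : ∃ k : K, k • u = v := by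
  have hker : Module.finrank K (LinearMap.ker M.mulVecLin) = 1 := by
    have h := M.mulVecLin.finrank_range_add_finrank_ker
    rw [Module.finrank_fintype_fun_eq_card, ← hM] at h
    exact Nat.add_left_cancel h
  have hu' : (⟨u, hMu⟩ : LinearMap.ker M.mulVecLin) ≠ 0 := fun h => hu (congrArg Subtype.val h)
  obtain ⟨k, hk⟩ := (finrank_eq_one_iff_of_nonzero' _ hu').1 hker ⟨v, hMv⟩
  exact ⟨k, congrArg Subtype.val hk⟩

theorem exists_nat_add_mul_eq {C N D m : ℤ} (hm : 0 < m) (h : (Int.gcd C m : ℤ) ∣ D - N) :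
    ∃ (k : ℕ) (M : ℤ), N + k * C = M * m + D := by
  obtain ⟨t, ht⟩ := h
  have bezout := Int.gcd_eq_gcd_ab C m
  set x := Int.gcdA C m
  set y := Int.gcdB C m
  refine ⟨(t * x % m).toNat, -(t * y) - t * x / m * C, ?_⟩
  rw [Int.toNat_of_nonneg (Int.emod_nonneg _ hm.ne'), Int.emod_def]
  linear_combination -ht - t * bezout

theorem exists_le_gcd_dvd_sub {m : ℤ} (hm : 0 < m) (C N : ℤ) :
    ∃ D : ℤ, 0 ≤ D ∧ D ≤ Int.gcd C m ∧ D < m ∧ (Int.gcd C m : ℤ) ∣ D - N ∧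
      (¬ (m ∣ C ∧ m ∣ N) → D ≠ 0) := by
  by_cases hmC : m ∣ C
  · have hgcd : (Int.gcd C m : ℤ) = m := Int.gcd_eq_right hm.le hmC
    have hlt := Int.emod_lt_of_pos N hm
    rw [hgcd]
    exact ⟨N % m, Int.emod_nonneg N hm.ne', hlt.le, hlt,
      (Int.dvd_iff_emod_eq_zero.2 <| by simp [Int.sub_emod]),
      fun h h0 => h ⟨hmC, Int.dvd_of_emod_eq_zero h0⟩⟩
  · have hpos : (0 : ℤ) < Int.gcd C m := by exact_mod_cast Int.gcd_pos_of_ne_zero_right C hm.ne'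
    have hlt : (Int.gcd C m : ℤ) < m :=
      (Int.le_of_dvd hm (Int.gcd_dvd_right C m)).lt_of_ne fun h => hmC (h ▸ Int.gcd_dvd_left C m)
    set q : ℤ := (Int.gcd C m : ℤ)
    have h0 := Int.emod_nonneg (-N) hpos.ne'
    have h1 := Int.emod_lt_of_pos (-N) hpos
    -- the representative of `N` modulo `q` in the interval `(0, q]`
    refine ⟨q - -N % q, by lia, by lia, by lia, ⟨1 + -N / q, ?_⟩, fun _ => by lia⟩
    linear_combination -Int.emod_add_mul_ediv (-N) q

theorem exists_gcd_pow_eq_gcd {p : ℕ} (hp : p.Prime) {C N : ℤ}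
    (h : ¬ ((p : ℤ) ^ 2 ∣ C ∧ (p : ℤ) ∣ N)) :
    ∃ e : ℕ, Int.gcd C ((p : ℤ) ^ e) = Int.gcd C p ∧ ¬ ((p : ℤ) ^ e ∣ C ∧ (p : ℤ) ^ e ∣ N) := by
  by_cases hCN : (p : ℤ) ∣ C ∧ (p : ℤ) ∣ N
  · obtain ⟨⟨t, rfl⟩, hN⟩ := hCN
    have hp2 : ¬ (p : ℤ) ^ 2 ∣ p * t := fun h2 => h ⟨h2, hN⟩
    refine ⟨2, ?_, fun h2 => hp2 h2.1⟩
    have hpt : ¬ (p : ℤ) ∣ t := fun ht => hp2 (by rw [sq]; exact mul_dvd_mul_left _ ht)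
    have hcop : Int.gcd t p = 1 := by
      rw [Int.gcd_comm, ← Int.isCoprime_iff_gcd_eq_one]
      exact (Nat.prime_iff_prime_int.1 hp).coprime_iff_not_dvd.2 hpt
    rw [sq, Int.gcd_mul_left, hcop]
    simp
  · exact ⟨1, by simp, by simpa using hCN⟩

variable {r : ℕ} {A : Matrix (Fin (r + 1)) (Fin (r + 1)) ℤ} {a c : Fin (r + 1) → ℤ}

theorem toWeight_add (g h : RootLattice r) :
    toWeight A (g + h) = toWeight A g + toWeight A h := by
  simp [toWeight, add_smul, Finset.sum_add_distrib]

theorem toWeight_zsmul (n : ℤ) (g : RootLattice r) :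
    toWeight A (n • g) = (n : ℂ) • toWeight A g := by
  simp [toWeight, Finset.smul_sum, mul_smul]

theorem toWeight_single (i : Fin (r + 1)) : toWeight A (Pi.single i 1) = simpleRoot A i := by
  simp [toWeight, Pi.single_apply]

theorem toWeight_simpleCoroot (g : RootLattice r) (j : Fin (r + 1)) :
    toWeight A g (simpleCoroot j) = (A.mulVec g j : ℂ) := by
  simp [toWeight, simpleRoot_simpleCoroot, Matrix.mulVec, dotProduct, mul_comm]

theorem form_add (μ : Weight r) (g h : RootLattice r) :
    form a c μ (g + h) = form a c μ g + form a c μ h := by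
  simp [form, add_mul, Finset.sum_add_distrib]

theorem form_zsmul (μ : Weight r) (n : ℤ) (g : RootLattice r) :
    form a c μ (n • g) = n * form a c μ g := by
  simp [form, Finset.mul_sum, mul_assoc]

theorem form_single (μ : Weight r) (i : Fin (r + 1)) :
    form a c μ (Pi.single i 1) = (c i : ℂ) / a i * μ (simpleCoroot i) := by
  simp [form, Pi.single_apply]

theorem form_weight_add (μ ν : Weight r) (g : RootLattice r) :
    form a c (μ + ν) g = form a c μ g + form a c ν g := by
  simp [form, mul_add, Finset.sum_add_distrib]

theorem form_weight_smul (z : ℂ) (μ : Weight r) (g : RootLattice r) :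
    form a c (z • μ) g = z * form a c μ g := by
  simp [form, Finset.mul_sum, mul_left_comm]

theorem form_mark (ha : ∀ j, a j ≠ 0) (μ : Weight r) : form a c μ a = level c μ := by
  rw [form, level, map_sum]
  refine Finset.sum_congr rfl fun j _ => ?_
  rw [mul_div_cancel₀ _ (Int.cast_ne_zero.2 (ha j)), map_smul, smul_eq_mul]

theorem toWeight_mark_simpleCoroot (ha : A.mulVec a = 0) (j : Fin (r + 1)) :
    toWeight A a (simpleCoroot j) = 0 := by
  rw [toWeight_simpleCoroot, ha, Pi.zero_apply, Int.cast_zero]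

theorem form_toWeight_mark (ha : A.mulVec a = 0) (g : RootLattice r) :
    form a c (toWeight A a) g = 0 := by
  simp [form, toWeight_mark_simpleCoroot ha]

theorem level_add_of_simpleCoroot_eq_one {ρ : Weight r} (hρ : ∀ j, ρ (simpleCoroot j) = 1)
    (μ : Weight r) : level c (μ + ρ) = level c μ + ∑ j, (c j : ℂ) := by
  simp [level, hρ, mul_add, Finset.sum_add_distrib]

theorem mul_symm_of_rank_eq {ε : Fin (r + 1) → ℚ} (hε0 : ∀ i, ε i ≠ 0)
    (hε : ∀ i j, ε i * (A i j : ℚ) = ε j * (A j i : ℚ))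
    (hA : (A.map (Int.cast : ℤ → ℚ)).rank = r) (ha0 : ∀ i, a i ≠ 0) (ha : A.mulVec a = 0)
    (hc0 : c ≠ 0) (hc : A.transpose.mulVec c = 0) (i j : Fin (r + 1)) :
    c i * a j * A i j = c j * a i * A j i := by
  let T := (A.map (Int.cast : ℤ → ℚ)).transpose
  have hT : T.rank + 1 = Fintype.card (Fin (r + 1)) := by
    rw [Matrix.rank_transpose, hA, Fintype.card_fin]
  have hTc : T.mulVec (fun k => (c k : ℚ)) = 0 := funext fun k => by
    have h : ∑ x, (A x k : ℚ) * c x = 0 := by exact_mod_cast congrFun hc k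
    exact h
  have hTa : T.mulVec (fun k => ε k * a k) = 0 := funext fun k => by
    have h : ∑ x, (A k x : ℚ) * a x = 0 := by exact_mod_cast congrFun ha k
    calc ∑ x, (A x k : ℚ) * (ε x * a x) = ∑ x, ε k * ((A k x : ℚ) * a x) :=
          Finset.sum_congr rfl fun x _ => by linear_combination (a x : ℚ) * hε x k
      _ = 0 := by rw [← Finset.mul_sum, h, mul_zero]
  have hc0' : (fun k => (c k : ℚ)) ≠ 0 := fun h =>
    hc0 (funext fun k => Int.cast_eq_zero.1 (congrFun h k))
  obtain ⟨κ, hκ⟩ := exists_smul_eq_of_rank_add_one_eq_card hT hc0' hTc hTa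
  replace hκ : ∀ k, κ * c k = ε k * a k := congrFun hκ
  have hκ0 : κ ≠ 0 := by
    rintro rfl
    exact mul_ne_zero (hε0 i) (Int.cast_ne_zero.2 (ha0 i)) (by rw [← hκ, zero_mul])
  have key : κ * ((c i : ℚ) * a j * A i j) = κ * (c j * a i * A j i) := by
    linear_combination (a j : ℚ) * A i j * hκ i - (a i : ℚ) * A j i * hκ j
      + (a i : ℚ) * a j * hε i j
  exact_mod_cast mul_left_cancel₀ hκ0 key

theorem IsAffineGCM.hasMarks (hA : IsAffineGCM A) (ha : IsMarks A a)
    (hc : IsMarks A.transpose c) : HasMarks A a c where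
  diag := hA.diag
  mulVec_mark := ha.1.2
  mark_ne_zero i := (ha.1.1 i).ne'
  comark_ne_zero i := (hc.1.1 i).ne'
  symm := by
    obtain ⟨ε, hε0, hε⟩ := hA.symmetrizable
    have hc0 : c ≠ 0 := fun h => (hc.1.1 0).ne' (congrFun h 0)
    exact mul_symm_of_rank_eq hε0 hε hA.rank_eq (fun i => (ha.1.1 i).ne') ha.1.2 hc0 hc.1.2

namespace HasMarks

theorem div_mul_symm (hA : HasMarks A a c) (i j : Fin (r + 1)) :
    (c i : ℂ) / a i * A i j = (c j : ℂ) / a j * A j i := by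
  have h : (c i : ℂ) * a j * A i j = c j * a i * A j i := by exact_mod_cast hA.symm i j
  have hi : (a i : ℂ) ≠ 0 := Int.cast_ne_zero.2 (hA.mark_ne_zero i)
  have hj : (a j : ℂ) ≠ 0 := Int.cast_ne_zero.2 (hA.mark_ne_zero j)
  field_simp
  linear_combination h

theorem form_toWeight_comm (hA : HasMarks A a c) (g h : RootLattice r) :
    form a c (toWeight A g) h = form a c (toWeight A h) g := by
  simp only [form, toWeight_simpleCoroot, Matrix.mulVec, dotProduct, Int.cast_sum, Int.cast_mul,
    Finset.mul_sum]
  rw [Finset.sum_comm]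
  refine Finset.sum_congr rfl fun i _ => Finset.sum_congr rfl fun j _ => ?_
  linear_combination (g i : ℂ) * h j * hA.div_mul_symm j i

theorem normSq_add_zsmul (hA : HasMarks A a c) (g h : RootLattice r) (n : ℤ) :
    normSq A a c (g + n • h) =
      normSq A a c g + 2 * n * form a c (toWeight A g) h + n ^ 2 * normSq A a c h := by
  simp only [normSq, toWeight_add, toWeight_zsmul, form_add, form_zsmul, form_weight_add,
    form_weight_smul, hA.form_toWeight_comm h g]
  ring

theorem normSq_add_zsmul_mark (hA : HasMarks A a c) (g : RootLattice r) (n : ℤ) :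
    normSq A a c (g + n • a) = normSq A a c g := by
  rw [hA.normSq_add_zsmul, hA.form_toWeight_comm, normSq, normSq,
    form_toWeight_mark hA.mulVec_mark, form_toWeight_mark hA.mulVec_mark, mul_zero, mul_zero,
    add_zero, add_zero]

theorem normSq_single (hA : HasMarks A a c) (i : Fin (r + 1)) :
    normSq A a c (Pi.single i 1) = 2 * ((c i : ℂ) / a i) := by
  rw [normSq, form_single, toWeight_single, simpleRoot_simpleCoroot, hA.diag, mul_comm,
    Int.cast_ofNat]

theorem normSq_simpleReflection (hA : HasMarks A a c) (i : Fin (r + 1)) (g : RootLattice r) :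
    normSq A a c (simpleReflection A i g) = normSq A a c g := by
  rw [simpleReflection, sub_eq_add_neg, ← neg_smul, hA.normSq_add_zsmul, form_single,
    toWeight_simpleCoroot, hA.normSq_single]
  push_cast
  ring

theorem corootPairing_add_zsmul_mark (hA : HasMarks A a c) (μ : Weight r) (g : RootLattice r)
    (n : ℤ) : corootPairing A a c μ (g + n • a) =
      corootPairing A a c μ g + n * (2 / normSq A a c g * level c μ) := by
  rw [corootPairing, hA.normSq_add_zsmul_mark, form_add, form_zsmul, form_mark hA.mark_ne_zero,
    corootPairing]
  ring

end HasMarks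

theorem IsCoroot.two_mul_form {g : RootLattice r} {m : Fin (r + 1) → ℤ}
    (hm : IsCoroot A a c g m) (μ : Weight r) :
    2 * form a c μ g = (∑ j, (m j : ℂ) * μ (simpleCoroot j)) * normSq A a c g := by
  rw [form, Finset.mul_sum, Finset.sum_mul]
  refine Finset.sum_congr rfl fun j _ => ?_
  linear_combination μ (simpleCoroot j) * hm j

theorem HasMarks.isCoroot_single (hA : HasMarks A a c) (i : Fin (r + 1)) :
    IsCoroot A a c (Pi.single i 1) (Pi.single i 1) := fun j => by
  rcases eq_or_ne j i with rfl | hji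
  · simp [hA.normSq_single]
  · simp [hji]

theorem IsCoroot.reflect {g : RootLattice r} {m : Fin (r + 1) → ℤ}
    (hm : IsCoroot A a c g m) (hA : HasMarks A a c) (i : Fin (r + 1)) :
    IsCoroot A a c (simpleReflection A i g) (simpleReflection A.transpose i m) := fun j => by
  rw [hA.normSq_simpleReflection]
  rcases eq_or_ne j i with rfl | hji
  · have hpair : 2 * ((c j : ℂ) / a j * A.mulVec g j) =
        (A.transpose.mulVec m j : ℂ) * normSq A a c g := by
      have h := hm.two_mul_form (simpleRoot A j)
      rw [← toWeight_single, hA.form_toWeight_comm, form_single, toWeight_simpleCoroot] at h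
      simpa [toWeight_single, simpleRoot_simpleCoroot, Matrix.mulVec, dotProduct, mul_comm]
        using h
    simp only [simpleReflection, Pi.sub_apply, Pi.smul_apply, Pi.single_eq_same,
      smul_eq_mul, mul_one, Int.cast_sub]
    linear_combination hm j - hpair
  · simpa [simpleReflection, hji] using hm j

namespace IsRealRoot

theorem exists_isCoroot (hA : HasMarks A a c) {g : RootLattice r} (hg : IsRealRoot A g) :
    ∃ m, IsCoroot A a c g m := by
  induction hg with
  | simple i => exact ⟨_, hA.isCoroot_single i⟩
  | reflect i g _ ih =>
    obtain ⟨m, hm⟩ := ih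
    exact ⟨_, hm.reflect hA i⟩

theorem normSq_ne_zero (hA : HasMarks A a c) {g : RootLattice r} (hg : IsRealRoot A g) :
    normSq A a c g ≠ 0 := by
  induction hg with
  | simple i =>
    rw [hA.normSq_single]
    exact mul_ne_zero two_ne_zero (div_ne_zero (Int.cast_ne_zero.2 (hA.comark_ne_zero i))
      (Int.cast_ne_zero.2 (hA.mark_ne_zero i)))
  | reflect i g _ ih => rwa [hA.normSq_simpleReflection]

theorem toWeight_ne_zero (hA : HasMarks A a c) {g : RootLattice r} (hg : IsRealRoot A g) :
    toWeight A g ≠ 0 := fun h =>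
  hg.normSq_ne_zero hA (by simp [normSq, form, h])

theorem exists_corootPairing_eq (hA : HasMarks A a c) {g : RootLattice r} (hg : IsRealRoot A g)
    {μ : Weight r} (hμ : ∀ j, ∃ n : ℤ, μ (simpleCoroot j) = n) :
    ∃ n : ℤ, (n : ℂ) = corootPairing A a c μ g := by
  obtain ⟨m, hm⟩ := hg.exists_isCoroot hA
  choose n hn using hμ
  refine ⟨∑ j, m j * n j, ?_⟩
  rw [corootPairing, eq_div_iff (hg.normSq_ne_zero hA), hm.two_mul_form]
  simp only [hn, Int.cast_sum, Int.cast_mul]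

end IsRealRoot

theorem isPosRealRoot_of_mem_baseRoots (ha : ∀ j, 0 ≤ a j) {i : ℕ} {g : RootLattice r}
    (hg : g ∈ baseRoots A a i) (k : ℕ) : IsPosRealRoot A (g + ((k : ℤ) * i) • a) :=
  ⟨(hg.2.1 _).2 (dvd_mul_left _ _), fun j =>
    add_nonneg (hg.1.2 j) (mul_nonneg (by positivity) (ha j))⟩

theorem mem_dominantWeights_iff {μ : Weight r} :
    μ ∈ dominantWeights r ↔ ∀ j, ∃ n : ℤ, 0 ≤ n ∧ μ (simpleCoroot j) = n := by
  refine forall_congr' fun j => ⟨fun ⟨n, hn⟩ => ⟨n, n.cast_nonneg, by exact_mod_cast hn⟩,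
    fun ⟨n, hn0, hn⟩ => ?_⟩
  lift n to ℕ using hn0
  exact ⟨n, by exact_mod_cast hn⟩

theorem sub_smul_mem_dominantWeights {μ : Weight r} {g : RootLattice r} {q D : ℤ}
    (hμ : μ ∈ dominantWeights r) (hq : μ - (q : ℂ) • toWeight A g ∈ dominantWeights r)
    (hD0 : 0 ≤ D) (hDq : D ≤ q) : μ - (D : ℂ) • toWeight A g ∈ dominantWeights r := by
  rw [mem_dominantWeights_iff] at *
  intro j
  obtain ⟨n, hn0, hn⟩ := hμ j
  obtain ⟨k, hk0, hk⟩ := hq j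
  simp only [LinearMap.sub_apply, LinearMap.smul_apply, toWeight_simpleCoroot, smul_eq_mul, hn]
    at hk ⊢
  have hk' : n - q * A.mulVec g j = k := by exact_mod_cast hk
  refine ⟨n - D * A.mulVec g j, ?_, by push_cast; ring⟩
  rcases le_total 0 (A.mulVec g j) with h | h <;> nlinarith

theorem sub_smul_add_zsmul_mark_mem_dominantWeights_iff (ha : A.mulVec a = 0) {μ : Weight r}
    {g : RootLattice r} {z : ℂ} {n : ℤ} :
    μ - z • toWeight A (g + n • a) ∈ dominantWeights r ↔
      μ - z • toWeight A g ∈ dominantWeights r := by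
  simp only [dominantWeights, Set.mem_ofPred_eq, toWeight_add, toWeight_zsmul, LinearMap.sub_apply,
    LinearMap.smul_apply, LinearMap.add_apply, toWeight_mark_simpleCoroot ha, smul_zero, add_zero]

theorem dotReflection_eq_sub {ρ ν : Weight r} {g : RootLattice r} {m D : ℤ}
    (h : corootPairing A a c (ν + ρ) g = ((m + D : ℤ) : ℂ)) :
    dotReflection A a c ρ g m ν = ν - (D : ℂ) • toWeight A g := by
  rw [dotReflection, affineReflection, h]
  push_cast
  module

theorem isMirroredAt_sub_smul {ρ ν : Weight r} {g : RootLattice r} {p e : ℕ} {M D : ℤ}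
    (hν : ν ∈ dominantWeights r) (hD : ν - (D : ℂ) • toWeight A g ∈ dominantWeights r)
    (hD0 : 0 ≤ D) (hDe : D < (p : ℤ) ^ e)
    (h : corootPairing A a c (ν + ρ) g = ((M * (p : ℤ) ^ e + D : ℤ) : ℂ)) :
    IsMirroredAt A a c ρ p g e (ν - (D : ℂ) • toWeight A g) ν :=
  ⟨hD, hν, M, D, h, hD0, hDe, (dotReflection_eq_sub h).symm⟩

theorem exists_isMirroredAt (hA : HasMarks A a c) {ρ lam : Weight r} {p : ℕ} (hp : 0 < p)
    (hlam : lam ∈ dominantWeights r) {i : ℕ} {γ₀ : RootLattice r}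
    (hγ₀ : ∀ k : ℕ, IsPosRealRoot A (γ₀ + ((k : ℤ) * i) • a)) {C N : ℤ}
    (hC : (C : ℂ) = 2 * (i : ℂ) / normSq A a c γ₀ * level c (lam + ρ))
    (hN : (N : ℂ) = corootPairing A a c (lam + ρ) γ₀) (e : ℕ)
    (hdom : lam - (Int.gcd C ((p : ℤ) ^ e) : ℂ) • toWeight A γ₀ ∈ dominantWeights r) :
    ∃ μ ∈ dominantWeights r, (¬ ((p : ℤ) ^ e ∣ C ∧ (p : ℤ) ^ e ∣ N) → μ ≠ lam) ∧
      ∃ γ, IsPosRealRoot A γ ∧ IsMirroredAt A a c ρ p γ e μ lam := by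
  have hpe : 0 < (p : ℤ) ^ e := by positivity
  obtain ⟨D, hD0, hDq, hDe, hDN, hDne⟩ := exists_le_gcd_dvd_sub hpe C N
  obtain ⟨k, M, hk⟩ := exists_nat_add_mul_eq hpe hDN
  have hpair : corootPairing A a c (lam + ρ) (γ₀ + ((k : ℤ) * i) • a) =
      ((M * (p : ℤ) ^ e + D : ℤ) : ℂ) := by
    rw [hA.corootPairing_add_zsmul_mark, ← hk, ← hN]
    push_cast
    rw [hC]
    ring
  have hμ : lam - (D : ℂ) • toWeight A (γ₀ + ((k : ℤ) * i) • a) ∈ dominantWeights r :=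
    (sub_smul_add_zsmul_mark_mem_dominantWeights_iff hA.mulVec_mark).2
      (sub_smul_mem_dominantWeights hlam (by exact_mod_cast hdom) hD0 hDq)
  refine ⟨_, hμ, fun hCN => ?_, _, hγ₀ k, isMirroredAt_sub_smul hlam hμ hD0 hDe hpair⟩
  rw [Ne, sub_eq_self]
  exact smul_ne_zero (Int.cast_ne_zero.2 (hDne hCN)) ((hγ₀ k).1.toWeight_ne_zero hA)

theorem eq_sum_simpleCoroot_add_scaling (x : Cartan r) :
    x = ∑ j, x.1 j • simpleCoroot j + x.2 • scaling r := by
  refine Prod.ext (funext fun k => ?_) ?_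
  · simp [simpleCoroot, scaling, Prod.fst_sum, Pi.single_apply]
  · simp [simpleCoroot, scaling, Prod.snd_sum]

theorem eq_sum_fundamentalWeight {μ : Weight r} (h : μ (scaling r) = 0) :
    μ = ∑ j, μ (simpleCoroot j) • fundamentalWeight j := by
  refine LinearMap.ext fun x => ?_
  conv_lhs => rw [eq_sum_simpleCoroot_add_scaling x]
  simp [h, fundamentalWeight, mul_comm]

theorem exists_eq_sum_fundamentalWeight {μ : Weight r} (hμ : μ ∈ dominantWeights r)
    (h : μ (scaling r) = 0) : ∃ ξ : Fin (r + 1) → ℕ, μ = ∑ j, (ξ j : ℂ) • fundamentalWeight j := by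
  choose ξ hξ using hμ
  refine ⟨ξ, (eq_sum_fundamentalWeight h).trans ?_⟩
  simp only [hξ]

theorem mainTheorem8_general (hA : HasMarks A a c) {ρ : Weight r}
    (hρ : ∀ j, ρ (simpleCoroot j) = 1) {p : ℕ} (hp : 0 < p) {lam : Weight r}
    (hlam : lam ∈ dominantWeights r) {i : ℕ} {γ₀ : RootLattice r}
    (hγ₀ : ∀ k : ℕ, IsPosRealRoot A (γ₀ + ((k : ℤ) * i) • a)) :
    ∃ C N : ℤ,
      (C : ℂ) = 2 * (i : ℂ) / normSq A a c γ₀ * (level c lam + ∑ j, (c j : ℂ)) ∧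
      (N : ℂ) = corootPairing A a c (lam + ρ) γ₀ ∧
      (lam - (Int.gcd C p : ℂ) • toWeight A γ₀ ∈ dominantWeights r →
        (∃ μ ∈ dominantWeights r, ∃ γ, IsPosRealRoot A γ ∧ IsMirrored A a c ρ p γ μ lam) ∧
        (lam (scaling r) = 0 → lam ∈ Yplus A a c ρ p)) ∧
      (∀ e : ℕ, ¬ ((p : ℤ) ^ e ∣ C ∧ (p : ℤ) ^ e ∣ N) →
        lam - (Int.gcd C ((p : ℤ) ^ e) : ℂ) • toWeight A γ₀ ∈ dominantWeights r →
        ∃ μ ∈ dominantWeights r, μ ≠ lam ∧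
          ∃ γ, IsPosRealRoot A γ ∧ IsMirrored A a c ρ p γ μ lam) := by
  have hintegral : ∀ j, ∃ n : ℤ, (lam + ρ) (simpleCoroot j) = n := fun j => by
    obtain ⟨n, hn⟩ := hlam j
    exact ⟨n + 1, by simp [hn, hρ]⟩
  obtain ⟨N, hN⟩ := (hγ₀ 0).1.exists_corootPairing_eq hA hintegral
  obtain ⟨N', hN'⟩ := (hγ₀ 1).1.exists_corootPairing_eq hA hintegral
  rw [Nat.cast_zero, zero_mul, zero_smul, add_zero] at hN
  have hC : ((N' - N : ℤ) : ℂ) = 2 * (i : ℂ) / normSq A a c γ₀ * level c (lam + ρ) := by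
    rw [Int.cast_sub, hN', hN, hA.corootPairing_add_zsmul_mark]
    push_cast
    ring
  have hmirror := exists_isMirroredAt hA hp hlam hγ₀ hC hN
  rw [level_add_of_simpleCoroot_eq_one hρ] at hC
  refine ⟨N' - N, N, hC, hN, fun hdom => ?_, fun e he hdom => ?_⟩
  · obtain ⟨μ, hμ, -, γ, hγ, hmir⟩ := hmirror 1 (by rwa [pow_one])
    have hex : ∃ μ ∈ dominantWeights r, ∃ γ, IsPosRealRoot A γ ∧ IsMirrored A a c ρ p γ μ lam :=
      ⟨μ, hμ, γ, hγ, 1, one_pos, hmir⟩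
    exact ⟨hex, fun h0 => ⟨exists_eq_sum_fundamentalWeight hlam h0, hex⟩⟩
  · obtain ⟨μ, hμ, hne, γ, hγ, hmir⟩ := hmirror e hdom
    have he0 : 0 < e := Nat.pos_of_ne_zero fun h => he (by simp [h])
    exact ⟨μ, hμ, hne he, γ, hγ, e, he0, hmir⟩

end AffineWeyl

open AffineWeyl in
theorem mainTheorem8 {r : ℕ} (A : Matrix (Fin (r + 1)) (Fin (r + 1)) ℤ) (hA : IsAffineGCM A)
    (a c : Fin (r + 1) → ℤ) (ha : IsMarks A a) (hc : IsMarks A.transpose c)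
    (ρ : Weight r) (hρ : ∀ i, ρ (simpleCoroot i) = 1)
    (p : ℕ) (hp : p.Prime)
    (lam : Weight r) (hlam : lam ∈ dominantWeights r) (l : ℤ) (hl : level c lam = (l : ℂ))
    (i : ℕ) (hi : i = 1 ∨ i = 2 ∨ i = 3) (γ₀ : RootLattice r) (hγ₀ : γ₀ ∈ baseRoots A a i) :
    ∃ C N : ℤ,
      (C : ℂ) = 2 * (i : ℂ) / normSq A a c γ₀ * ((l : ℂ) + ∑ j, (c j : ℂ)) ∧
      (N : ℂ) = corootPairing A a c (lam + ρ) γ₀ ∧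
      -- the implication with the definition of mirrored weights as it stands
      (lam - (Int.gcd C p : ℂ) • toWeight A γ₀ ∈ dominantWeights r →
        (∃ μ ∈ dominantWeights r, ∃ γ, IsPosRealRoot A γ ∧ IsMirrored A a c ρ p γ μ lam) ∧
        (lam (scaling r) = 0 → lam ∈ Yplus A a c ρ p)) ∧
      -- the same with a mirrored weight different from `lam`
      (lam - (Int.gcd C p : ℂ) • toWeight A γ₀ ∈ dominantWeights r →
        ¬ ((p : ℤ) ^ 2 ∣ C ∧ (p : ℤ) ∣ N) →
        ∃ μ ∈ dominantWeights r, μ ≠ lam ∧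
          ∃ γ, IsPosRealRoot A γ ∧ IsMirrored A a c ρ p γ μ lam) ∧
      -- the same with a power `p ^ e` that does not divide `C`
      (∀ e : ℕ, ¬ (p : ℤ) ^ e ∣ C →
        lam - (Int.gcd C ((p : ℤ) ^ e) : ℂ) • toWeight A γ₀ ∈ dominantWeights r →
        ∃ μ ∈ dominantWeights r, μ ≠ lam ∧
          ∃ γ, IsPosRealRoot A γ ∧ IsMirrored A a c ρ p γ μ lam) := by
  obtain ⟨C, N, hC, hN, hmirrored, hmirrored_ne⟩ := mainTheorem8_general (hA.hasMarks ha hc) hρ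
    hp.pos hlam (isPosRealRoot_of_mem_baseRoots (fun j => (ha.1.1 j).le) hγ₀)
  refine ⟨C, N, hl ▸ hC, hN, hmirrored, fun hdom hCN => ?_, fun e he => hmirrored_ne e (he ·.1)⟩
  obtain ⟨e, hgcd, he⟩ := exists_gcd_pow_eq_gcd hp hCN
  exact hmirrored_ne e he (hgcd ▸ hdom)
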